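/- Let $\Lambda_A$ be the set of affine $\lambda$-terms, i.e. the untyped $\lambda$-terms (up to renaming of bound variables) in which every abstraction $\lambda x.M$ satisfies that $x$ has at most one free occurrence in $M$. Order the $\beta$-redexes of a term by the position of their beginning; let LO be the strategy that contracts the leftmost redex, and RI the one that contracts the rightmost redex. For $\varepsilon\in[0,1]$ let $\mathsf P_\varepsilon$ be the probabilistic strategy that, on a term not in normal form, contracts the LO-redex with probability $\varepsilon$ and the RI-redex with probability $1-\varepsilon$ (the probabilities add up if both contractions give the same term). For a term $M$ let $N_{\mathsf P_\varepsilon}(M)\in[0,\infty]$ be the expected number of reduction steps to normal form from $M$, that is, the expectation of the number of steps after which the Markov chain induced by $\mathsf P_\varepsilon$ on terms, with all normal forms collapsed to one absorbing state, and started at $M$, is in that absorbing state ($0$ if $M$ is in normal form). Then for every $M\in\Lambda_A$ the function $\varepsilon\mapsto N_{\mathsf P_\varepsilon}(M)$ on $[0,1]$ attains its minimum at $\varepsilon=1$: $$N_{\mathsf P_1}(M)\le N_{\mathsf P_\varepsilon}(M)\qquad\text{for all }\varepsilon\in[0,1].$$ Moreover the minimum is the number of steps of leftmost-outermost reduction: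 the LO-reduction sequence from $M$ reaches a normal form after a finite number $n$ of steps, and $N_{\mathsf P_1}(M)=n$. -/

import Mathlib

open scoped ENNReal

namespace RandStrat

/-! ### Abstract reduction systems and (probabilistic) reduction strategies -/

section ARS

variable {S : Type*} (r : S → S → Prop)

/-- `s` is in normal form for the reduction relation `r`. -/
def IsNF (s : S) : Prop := ∀ t, ¬ r s t

/-- A deterministic reduction strategy: a partial function that is defined exactly on the elements
that are not in normal form, and that picks one of the one-step reducts. -/
structure DetStrategy where
  toFun : S → Option S
  eq_none_iff : ∀ s, toFun s = none ↔ IsNF r s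
  rel_of_eq_some : ∀ s t, toFun s = some t → r s t

variable {r} in
/-- `D.NormalizesIn a n`: the reduction sequence `a = σ 0 → σ 1 → ⋯ → σ n` that follows the
strategy `D` ends in a normal form, so that the number of steps of `D` from `a` is `n`. -/
def DetStrategy.NormalizesIn (D : DetStrategy r) (a : S) (n : ℕ) : Prop :=
  ∃ σ : ℕ → S, σ 0 = a ∧ (∀ i < n, D.toFun (σ i) = some (σ (i + 1))) ∧ IsNF r (σ n)

/-- A probabilistic abstract reduction system on the reduction relation `r`: a partial function
to probability distributions, undefined exactly on the normal forms, and supported on the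
one-step reducts. -/
structure PARS where
  toFun : S → Option (PMF S)
  eq_none_iff : ∀ s, toFun s = none ↔ IsNF r s
  rel_of_mem_support : ∀ s μ, toFun s = some μ → ∀ t ∈ μ.support, r s t

/-- The equivalence relation that identifies all the normal forms. -/
def trmSetoid : Setoid S where
  r s t := s = t ∨ (IsNF r s ∧ IsNF r t)
  iseqv := by
    refine ⟨fun _ => Or.inl rfl, ?_, ?_⟩
    · rintro s t (h | ⟨h, k⟩)
      · exact Or.inl h.symm
      · exact Or.inr ⟨k, h⟩
    · rintro s t u (rfl | ⟨h, k⟩) (rfl | ⟨h', k'⟩)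
      · exact Or.inl rfl
      · exact Or.inr ⟨h', k'⟩
      · exact Or.inr ⟨h, k⟩
      · exact Or.inr ⟨h, k'⟩

/-- The state space of the Markov chain of a probabilistic abstract reduction system: all normal
forms are collapsed to one state. -/
def State : Type _ := Quotient (trmSetoid r)

/-- The state of an element. -/
def State.mk (s : S) : State r := Quotient.mk (trmSetoid r) s

instance : MeasurableSpace (State r) := ⊤

/-- The (at most one) terminal state, that is, the class of the normal forms. -/
def trm : Set (State r) := {q | ∃ s, IsNF r s ∧ State.mk r s = q}

variable {r}

/-- The transition matrix of the Markov chain: from the class of a reducible `s` one moves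
according to the distribution chosen by the strategy, and the terminal state is absorbing. -/
noncomputable def PARS.transition (P : PARS r) : State r → PMF (State r) :=
  Quotient.lift
    (fun s => match P.toFun s with
      | none => PMF.pure (State.mk r s)
      | some μ => μ.map (State.mk r))
    (by
      rintro s t (rfl | ⟨h, k⟩)
      · rfl
      · simp only [(P.eq_none_iff s).2 h, (P.eq_none_iff t).2 k]
        exact congrArg PMF.pure (Quotient.sound (s := trmSetoid r) (Or.inr ⟨h, k⟩)))

/-- The one-step Markov kernel of the chain. -/
noncomputable def PARS.kernel (P : PARS r) : ProbabilityTheory.Kernel (State r) (State r) where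
  toFun q := (P.transition q).toMeasure
  measurable' := measurable_from_top

instance (P : PARS r) : ProbabilityTheory.IsMarkovKernel P.kernel :=
  ⟨fun q => inferInstanceAs (MeasureTheory.IsProbabilityMeasure (P.transition q).toMeasure)⟩

/-- The law of the next state given the history up to time `n`: it depends on the state at
time `n` only. -/
noncomputable def PARS.stepKernel (P : PARS r) (n : ℕ) :
    ProbabilityTheory.Kernel (Finset.Iic n → State r) (State r) :=
  P.kernel.comap (fun h => h ⟨n, Finset.mem_Iic.2 le_rfl⟩) (measurable_pi_apply _)

instance (P : PARS r) (n : ℕ) : ProbabilityTheory.IsMarkovKernel (P.stepKernel n) :=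
  inferInstanceAs (ProbabilityTheory.IsMarkovKernel (P.kernel.comap _ _))

/-- The law, on the space of trajectories, of the Markov chain started at `s`. -/
noncomputable def PARS.law (P : PARS r) (s : S) : MeasureTheory.Measure (ℕ → State r) :=
  ProbabilityTheory.Kernel.traj (X := fun _ => State r) P.stepKernel 0 (fun _ => State.mk r s)

variable (r) in
/-- The number of steps that a trajectory takes to reach the terminal state (`⊤` if it never
does; `0` if it starts there). -/
noncomputable def hitTime (ω : ℕ → State r) : ℕ∞ :=
  MeasureTheory.hittingAfter (fun (n : ℕ) (ω : ℕ → State r) => ω n) (trm r) 0 ω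

/-- The average derivation length from `s`: the expected number of reduction steps to
normal form, a number in `[0, ∞]`. -/
noncomputable def PARS.avgLength (P : PARS r) (s : S) : ℝ≥0∞ :=
  ∫⁻ ω, (hitTime r ω : ℝ≥0∞) ∂(P.law s)

end ARS

/-! ### The untyped lambda-calculus, in de Bruijn notation -/

/-- Lambda-terms up to renaming of bound variables; free variables are the dangling indices. -/
inductive Term : Type
  | var (i : ℕ) : Term
  | app (M N : Term) : Term
  | lam (M : Term) : Term

namespace Term

/-- Increment all the indices `≥ c`. -/
def shift : ℕ → Term → Term
  | c, var i => if i < c then var i else var (i + 1)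
  | c, app M N => app (shift c M) (shift c N)
  | c, lam M => lam (shift (c + 1) M)

/-- Capture-avoiding substitution of `N` for the index `k`, whose binder disappears. -/
def subst : ℕ → Term → Term → Term
  | k, N, var i => if i < k then var i else if i = k then N else var (i - 1)
  | k, N, app M M' => app (subst k N M) (subst k N M')
  | k, N, lam M => lam (subst (k + 1) (shift 0 N) M)

/-- The contractum of the redex `app (lam M) N`. -/
def contractum (M N : Term) : Term := subst 0 N M

/-- The number of free occurrences of the index `k`. -/
def occ : ℕ → Term → ℕ
  | k, var i => if i = k then 1 else 0
  | k, app M N => occ k M + occ k N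
  | k, lam M => occ (k + 1) M

/-- Terms of the affine calculus: every abstraction binds at most one occurrence. -/
inductive Affine : Term → Prop
  | var (i : ℕ) : Affine (var i)
  | lam {M : Term} : Affine M → occ 0 M ≤ 1 → Affine (lam M)
  | app {M N : Term} : Affine M → Affine N → Affine (app M N)

/-- The number of nodes of a term. -/
def size : Term → ℕ
  | var _ => 1
  | app M N => 1 + size M + size N
  | lam M => 1 + size M

end Term

/-- One-hole contexts. -/
inductive Ctx : Type
  | hole : Ctx
  | appL (C : Ctx) (M : Term) : Ctx
  | appR (M : Term) (C : Ctx) : Ctx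
  | lam (C : Ctx) : Ctx

namespace Ctx

/-- Fill the hole (capturing variables). -/
def fill : Ctx → Term → Term
  | hole, t => t
  | appL C M, t => .app (C.fill t) M
  | appR M C, t => .app M (C.fill t)
  | lam C, t => .lam (C.fill t)

/-- The position at which the hole begins: the number of nodes that begin strictly before it
when the term is read from left to right. -/
def start : Ctx → ℕ
  | hole => 0
  | appL C _ => 1 + C.start
  | appR M C => 1 + M.size + C.start
  | lam C => 1 + C.start

theorem start_lt_size (C : Ctx) (t : Term) : C.start < (C.fill t).size := by
  induction C with
  | hole => cases t <;> simp [start, fill, Term.size]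
  | appL C M ih => simp only [start, fill, Term.size]; omega
  | appR M C ih => simp only [start, fill, Term.size]; omega
  | lam C ih => simp only [start, fill, Term.size]; omega

theorem eq_of_start_eq : ∀ (C D : Ctx) (s t : Term), C.fill s = D.fill t → C.start = D.start →
    C = D
  | hole, D, s, t, _, h => by
    cases D with
    | hole => rfl
    | appL D N => simp only [start] at h; omega
    | appR N D => simp only [start] at h; omega
    | lam D => simp only [start] at h; omega
  | appL C M, D, s, t, e, h => by
    cases D with
    | hole => simp only [start] at h; omega
    | appL D N =>
      simp only [fill, Term.app.injEq, start] at e h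
      rw [eq_of_start_eq C D s t e.1 (by omega), e.2]
    | appR N D =>
      simp only [fill, Term.app.injEq, start] at e h
      have := start_lt_size C s
      rw [e.1] at this
      omega
    | lam D => simp [fill] at e
  | appR M C, D, s, t, e, h => by
    cases D with
    | hole => simp only [start] at h; omega
    | appL D N =>
      simp only [fill, Term.app.injEq, start] at e h
      have := start_lt_size D t
      rw [← e.1] at this
      omega
    | appR N D =>
      simp only [fill, Term.app.injEq, start] at e h
      rw [e.1] at h
      rw [eq_of_start_eq C D s t e.2 (by omega), e.1]
    | lam D => simp [fill] at e
  | lam C, D, s, t, e, h => by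
    cases D with
    | hole => simp only [start] at h; omega
    | appL D N => simp [fill] at e
    | appR N D => simp [fill] at e
    | lam D =>
      simp only [fill, Term.lam.injEq, start] at e h
      rw [eq_of_start_eq C D s t e (by omega)]

theorem fill_inj (C : Ctx) {s t : Term} (h : C.fill s = C.fill t) : s = t := by
  induction C with
  | hole => exact h
  | appL C M ih => exact ih (Term.app.inj h).1
  | appR M C ih => exact ih (Term.app.inj h).2
  | lam C ih => exact ih (Term.lam.inj h)

end Ctx

namespace Term

/-- `t` has the redex `app (lam M) N` at the position of the hole of `C`. -/
def RedexAt (t : Term) (C : Ctx) (M N : Term) : Prop := t = C.fill (app (lam M) N)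

/-- One-step beta-reduction. -/
def Beta (t u : Term) : Prop :=
  ∃ C M N, t.RedexAt C M N ∧ u = C.fill (contractum M N)

/-- The reduction step that contracts the leftmost redex, where redexes are ordered by the
position of their beginning. -/
def LeftmostStep (t u : Term) : Prop :=
  ∃ C M N, t.RedexAt C M N ∧ u = C.fill (contractum M N) ∧
    ∀ D P Q, t.RedexAt D P Q → C.start ≤ D.start

/-- The reduction step that contracts the rightmost redex, where redexes are ordered by the
position of their beginning. -/
def RightmostStep (t u : Term) : Prop :=
  ∃ C M N, t.RedexAt C M N ∧ u = C.fill (contractum M N) ∧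
    ∀ D P Q, t.RedexAt D P Q → D.start ≤ C.start

/-- Contraction of the leftmost(-outermost) redex, computed by recursion;
see `leftmost_eq_some_iff`. -/
def leftmost : Term → Option Term
  | var _ => none
  | lam M => (leftmost M).map lam
  | app (lam M) N => some (contractum M N)
  | app M N =>
    match leftmost M with
    | some M' => some (app M' N)
    | none => (leftmost N).map (app M)

/-- Contraction of `app M N` at the root, if it is a redex. -/
def rootStep : Term → Term → Option Term
  | lam P, N => some (contractum P N)
  | _, _ => none

/-- Contraction of the rightmost(-innermost) redex, computed by recursion;
see `rightmost_eq_some_iff`. -/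
def rightmost : Term → Option Term
  | var _ => none
  | lam M => (rightmost M).map lam
  | app M N =>
    match rightmost N with
    | some N' => some (app M N')
    | none =>
      match rightmost M with
      | some M' => some (app M' N)
      | none => rootStep M N

theorem not_redexAt_var (i : ℕ) (C : Ctx) (M N : Term) : ¬ (var i).RedexAt C M N := by
  cases C <;> simp [RedexAt, Ctx.fill]

theorem redexAt_lam {t : Term} {C : Ctx} {M N : Term} :
    (lam t).RedexAt C M N ↔ ∃ D, C = .lam D ∧ t.RedexAt D M N := by
  cases C <;> simp [RedexAt, Ctx.fill]

theorem redexAt_app {t s : Term} {C : Ctx} {M N : Term} :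
    (app t s).RedexAt C M N ↔ (C = .hole ∧ t = lam M ∧ s = N) ∨
      (∃ D, C = .appL D s ∧ t.RedexAt D M N) ∨ (∃ D, C = .appR t D ∧ s.RedexAt D M N) := by
  cases C <;> simp [RedexAt, Ctx.fill] <;> grind

/-- No redex at all. -/
theorem isNF_iff {t : Term} : IsNF Beta t ↔ ∀ C M N, ¬ t.RedexAt C M N := by
  constructor
  · intro h C M N hr
    exact h _ ⟨C, M, N, hr, rfl⟩
  · rintro h u ⟨C, M, N, hr, -⟩
    exact h C M N hr

theorem LeftmostStep.unique {t u v : Term} (hu : LeftmostStep t u) (hv : LeftmostStep t v) :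
    u = v := by
  obtain ⟨C, M, N, h, rfl, hC⟩ := hu
  obtain ⟨D, P, Q, k, rfl, hD⟩ := hv
  have e : C.fill (app (lam M) N) = D.fill (app (lam P) Q) := h.symm.trans k
  obtain rfl := Ctx.eq_of_start_eq C D _ _ e (le_antisymm (hC _ _ _ k) (hD _ _ _ h))
  have := Ctx.fill_inj C e
  simp only [app.injEq, lam.injEq] at this
  rw [this.1, this.2]

theorem RightmostStep.unique {t u v : Term} (hu : RightmostStep t u) (hv : RightmostStep t v) :
    u = v := by
  obtain ⟨C, M, N, h, rfl, hC⟩ := hu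
  obtain ⟨D, P, Q, k, rfl, hD⟩ := hv
  have e : C.fill (app (lam M) N) = D.fill (app (lam P) Q) := h.symm.trans k
  obtain rfl := Ctx.eq_of_start_eq C D _ _ e (le_antisymm (hD _ _ _ h) (hC _ _ _ k))
  have := Ctx.fill_inj C e
  simp only [app.injEq, lam.injEq] at this
  rw [this.1, this.2]

theorem leftmost_app_of_ne {M N : Term} (h : ∀ P, M ≠ lam P) :
    leftmost (app M N) = match leftmost M with
      | some M' => some (app M' N)
      | none => (leftmost N).map (app M) := by
  cases M with
  | lam P => exact absurd rfl (h P)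
  | var i => simp [leftmost]
  | app A B => rw [leftmost]; simp

theorem leftmost_spec (t : Term) : (leftmost t = none → ∀ C M N, ¬ t.RedexAt C M N) ∧
    ∀ u, leftmost t = some u → LeftmostStep t u := by
  induction t with
  | var i => exact ⟨fun _ => not_redexAt_var i, fun u h => by simp [leftmost] at h⟩
  | lam t ih =>
    constructor
    · intro h C M N hr
      obtain ⟨D, -, hD⟩ := redexAt_lam.1 hr
      exact ih.1 (by simpa [leftmost] using h) _ _ _ hD
    · intro u h
      simp only [leftmost, Option.map_eq_some_iff] at h
      obtain ⟨v, hv, rfl⟩ := h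
      obtain ⟨C, M, N, hr, rfl, hC⟩ := ih.2 v hv
      refine ⟨.lam C, M, N, redexAt_lam.2 ⟨C, rfl, hr⟩, rfl, fun D P Q hD => ?_⟩
      obtain ⟨E, rfl, hE⟩ := redexAt_lam.1 hD
      have := hC E P Q hE
      simp only [Ctx.start]; omega
  | app t s iht ihs =>
    by_cases ht : ∃ P, t = lam P
    · obtain ⟨P, rfl⟩ := ht
      constructor
      · intro h
        simp [leftmost] at h
      · intro u h
        simp only [leftmost, Option.some.injEq] at h
        exact ⟨.hole, P, s, rfl, h.symm, fun D _ _ _ => Nat.zero_le _⟩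
    · have ht' : ∀ P, t ≠ lam P := fun P h => ht ⟨P, h⟩
      rw [leftmost_app_of_ne ht']
      cases hl : leftmost t with
      | some t' =>
        refine ⟨fun h => by simp at h, fun u h => ?_⟩
        simp only [Option.some.injEq] at h
        subst h
        obtain ⟨C, M, N, hr, rfl, hC⟩ := iht.2 t' hl
        refine ⟨.appL C s, M, N, redexAt_app.2 (.inr (.inl ⟨C, rfl, hr⟩)), rfl,
          fun D P Q hD => ?_⟩
        have hlt := Ctx.start_lt_size C (app (lam M) N)
        rw [← hr] at hlt
        rcases redexAt_app.1 hD with ⟨-, h, -⟩ | ⟨E, rfl, hE⟩ | ⟨E, rfl, hE⟩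
        · exact absurd h (ht' P)
        · have := hC E P Q hE
          simp only [Ctx.start]; omega
        · simp only [Ctx.start]; omega
      | none =>
        constructor
        · intro h C M N hr
          simp only [Option.map_eq_none_iff] at h
          rcases redexAt_app.1 hr with ⟨-, h', -⟩ | ⟨E, rfl, hE⟩ | ⟨E, rfl, hE⟩
          · exact ht' M h'
          · exact iht.1 hl _ _ _ hE
          · exact ihs.1 h _ _ _ hE
        · intro u h
          simp only [Option.map_eq_some_iff] at h
          obtain ⟨v, hv, rfl⟩ := h
          obtain ⟨C, M, N, hr, rfl, hC⟩ := ihs.2 v hv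
          refine ⟨.appR t C, M, N, redexAt_app.2 (.inr (.inr ⟨C, rfl, hr⟩)), rfl,
            fun D P Q hD => ?_⟩
          rcases redexAt_app.1 hD with ⟨-, h', -⟩ | ⟨E, rfl, hE⟩ | ⟨E, rfl, hE⟩
          · exact absurd h' (ht' P)
          · exact absurd hE (iht.1 hl _ _ _)
          · have := hC E P Q hE
            simp only [Ctx.start]; omega

theorem rightmost_spec (t : Term) : (rightmost t = none → ∀ C M N, ¬ t.RedexAt C M N) ∧
    ∀ u, rightmost t = some u → RightmostStep t u := by
  induction t with
  | var i => exact ⟨fun _ => not_redexAt_var i, fun u h => by simp [rightmost] at h⟩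
  | lam t ih =>
    constructor
    · intro h C M N hr
      obtain ⟨D, -, hD⟩ := redexAt_lam.1 hr
      exact ih.1 (by simpa [rightmost] using h) _ _ _ hD
    · intro u h
      simp only [rightmost, Option.map_eq_some_iff] at h
      obtain ⟨v, hv, rfl⟩ := h
      obtain ⟨C, M, N, hr, rfl, hC⟩ := ih.2 v hv
      refine ⟨.lam C, M, N, redexAt_lam.2 ⟨C, rfl, hr⟩, rfl, fun D P Q hD => ?_⟩
      obtain ⟨E, rfl, hE⟩ := redexAt_lam.1 hD
      have := hC E P Q hE
      simp only [Ctx.start]; omega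
  | app t s iht ihs =>
    rw [rightmost]
    cases hs : rightmost s with
    | some s' =>
      refine ⟨fun h => by simp at h, fun u h => ?_⟩
      simp only [Option.some.injEq] at h
      subst h
      obtain ⟨C, M, N, hr, rfl, hC⟩ := ihs.2 s' hs
      refine ⟨.appR t C, M, N, redexAt_app.2 (.inr (.inr ⟨C, rfl, hr⟩)), rfl,
        fun D P Q hD => ?_⟩
      rcases redexAt_app.1 hD with ⟨rfl, -, -⟩ | ⟨E, rfl, hE⟩ | ⟨E, rfl, hE⟩
      · exact Nat.zero_le _
      · have hlt := Ctx.start_lt_size E (app (lam P) Q)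
        rw [← hE] at hlt
        simp only [Ctx.start]; omega
      · have := hC E P Q hE
        simp only [Ctx.start]; omega
    | none =>
      cases ht : rightmost t with
      | some t' =>
        refine ⟨fun h => by simp at h, fun u h => ?_⟩
        simp only [Option.some.injEq] at h
        subst h
        obtain ⟨C, M, N, hr, rfl, hC⟩ := iht.2 t' ht
        refine ⟨.appL C s, M, N, redexAt_app.2 (.inr (.inl ⟨C, rfl, hr⟩)), rfl,
          fun D P Q hD => ?_⟩
        rcases redexAt_app.1 hD with ⟨rfl, -, -⟩ | ⟨E, rfl, hE⟩ | ⟨E, rfl, hE⟩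
        · exact Nat.zero_le _
        · have := hC E P Q hE
          simp only [Ctx.start]; omega
        · exact absurd hE (ihs.1 hs _ _ _)
      | none =>
        cases t with
        | lam P =>
          refine ⟨fun h => by simp [rootStep] at h, fun u h => ?_⟩
          simp only [rootStep, Option.some.injEq] at h
          refine ⟨.hole, P, s, rfl, h.symm, fun D P' Q' hD => ?_⟩
          rcases redexAt_app.1 hD with ⟨rfl, -, -⟩ | ⟨E, rfl, hE⟩ | ⟨E, rfl, hE⟩
          · exact le_rfl
          · exact absurd hE (iht.1 ht _ _ _)
          · exact absurd hE (ihs.1 hs _ _ _)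
        | var i =>
          refine ⟨fun _ C M N hr => ?_, fun u h => by simp [rootStep] at h⟩
          rcases redexAt_app.1 hr with ⟨-, h, -⟩ | ⟨E, rfl, hE⟩ | ⟨E, rfl, hE⟩
          · simp at h
          · exact iht.1 ht _ _ _ hE
          · exact ihs.1 hs _ _ _ hE
        | app A B =>
          refine ⟨fun _ C M N hr => ?_, fun u h => by simp [rootStep] at h⟩
          rcases redexAt_app.1 hr with ⟨-, h, -⟩ | ⟨E, rfl, hE⟩ | ⟨E, rfl, hE⟩
          · simp at h
          · exact iht.1 ht _ _ _ hE
          · exact ihs.1 hs _ _ _ hE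

theorem leftmost_eq_some_iff {t u : Term} : leftmost t = some u ↔ LeftmostStep t u := by
  refine ⟨(leftmost_spec t).2 u, fun h => ?_⟩
  cases hl : leftmost t with
  | none =>
    obtain ⟨C, M, N, hr, -⟩ := h
    exact absurd hr ((leftmost_spec t).1 hl C M N)
  | some v => rw [((leftmost_spec t).2 v hl).unique h]

theorem rightmost_eq_some_iff {t u : Term} : rightmost t = some u ↔ RightmostStep t u := by
  refine ⟨(rightmost_spec t).2 u, fun h => ?_⟩
  cases hl : rightmost t with
  | none =>
    obtain ⟨C, M, N, hr, -⟩ := h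
    exact absurd hr ((rightmost_spec t).1 hl C M N)
  | some v => rw [((rightmost_spec t).2 v hl).unique h]

theorem leftmost_beta {t u : Term} (h : leftmost t = some u) : Beta t u := by
  obtain ⟨C, M, N, hr, hu, -⟩ := leftmost_eq_some_iff.1 h
  exact ⟨C, M, N, hr, hu⟩

theorem rightmost_beta {t u : Term} (h : rightmost t = some u) : Beta t u := by
  obtain ⟨C, M, N, hr, hu, -⟩ := rightmost_eq_some_iff.1 h
  exact ⟨C, M, N, hr, hu⟩

theorem leftmost_eq_none_iff {t : Term} : leftmost t = none ↔ IsNF Beta t := by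
  refine ⟨fun h => isNF_iff.2 ((leftmost_spec t).1 h), fun h => ?_⟩
  cases hl : leftmost t with
  | none => rfl
  | some v => exact absurd (leftmost_beta hl) (h v)

theorem rightmost_eq_none_iff {t : Term} : rightmost t = none ↔ IsNF Beta t := by
  refine ⟨fun h => isNF_iff.2 ((rightmost_spec t).1 h), fun h => ?_⟩
  cases hl : rightmost t with
  | none => rfl
  | some v => exact absurd (rightmost_beta hl) (h v)

end Term

/-! ### The strategies -/

/-- The leftmost-outermost strategy. -/
def LO : DetStrategy Term.Beta where
  toFun := Term.leftmost
  eq_none_iff _ := Term.leftmost_eq_none_iff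
  rel_of_eq_some _ _ := Term.leftmost_beta

/-- The rightmost-innermost strategy. -/
def RI : DetStrategy Term.Beta where
  toFun := Term.rightmost
  eq_none_iff _ := Term.rightmost_eq_none_iff
  rel_of_eq_some _ _ := Term.rightmost_beta

open Classical in
/-- The distribution that gives `a` with probability `ε` and `b` with probability `1 - ε`
(the two contributions add up if `a = b`). -/
noncomputable def mix {α : Type*} (ε : unitInterval) (a b : α) : PMF α :=
  ⟨fun c => (if c = a then ENNReal.ofReal ε else 0) + (if c = b then ENNReal.ofReal (1 - ε) else 0),
    by
      have h : ENNReal.ofReal ε + ENNReal.ofReal (1 - ε) = 1 := by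
        rw [← ENNReal.ofReal_add ε.2.1 (sub_nonneg.2 ε.2.2)]
        simp
      rw [← h]
      exact (hasSum_ite_eq a _).add (hasSum_ite_eq b _)⟩

open Classical in
theorem mem_support_mix {α : Type*} {ε : unitInterval} {a b c : α}
    (h : c ∈ (mix ε a b).support) : c = a ∨ c = b := by
  by_contra! hc
  refine h ?_
  change (if c = a then _ else _) + (if c = b then _ else _) = (0 : ℝ≥0∞)
  simp [hc.1, hc.2]

/-- The probabilistic strategy `P_ε`: contract the leftmost-outermost redex with
probability `ε`, and the rightmost-innermost one with probability `1 - ε`. -/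
noncomputable def Peps (ε : unitInterval) : PARS Term.Beta where
  toFun t :=
    match LO.toFun t, RI.toFun t with
    | some u, some v => some (mix ε u v)
    | _, _ => none
  eq_none_iff t := by
    cases hl : LO.toFun t with
    | none => simpa using (LO.eq_none_iff t).1 hl
    | some u =>
      cases hr : RI.toFun t with
      | none => simpa using (RI.eq_none_iff t).1 hr
      | some v => simpa using fun h => h u (LO.rel_of_eq_some t u hl)
  rel_of_mem_support t μ h s hs := by
    cases hl : LO.toFun t with
    | none => simp [hl] at h
    | some u =>
      cases hr : RI.toFun t with
      | none => simp [hl, hr] at h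
      | some v =>
        simp only [hl, hr, Option.some.injEq] at h
        subst h
        rcases mem_support_mix hs with rfl | rfl
        · exact LO.rel_of_eq_some t _ hl
        · exact RI.rel_of_eq_some t _ hr

end RandStrat

/-!
In the affine calculus leftmost reduction is a shortest reduction, so no strategy, probabilistic or
not, can beat it on any trajectory, let alone on average.

The length of leftmost reduction (`Term.LOLength`) is finite, because a step of an affine term
makes it smaller (`size_lt_of_beta`). The key fact is that an arbitrary step decreases this length
by at most one (`LOLength.of_beta`). It follows by induction from a diamond property
(`leftmost_diamond`): if `t` reduces to `v` by the leftmost step and to `u ≠ v` by another step,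
then the leftmost step from `u` leads to a term that `v` reaches in at most one step. Here
affineness matters: the redex contracted second is erased or survives as a single copy
(`Beta.subst_arg`), whereas in the full calculus it could be duplicated.

On the side of the Markov chain, nothing is needed beyond invariants of trajectories: a family of
sets of states that every transition of positive probability respects is respected by almost every
trajectory (`PARS.ae_forall_mem`). For an arbitrary strategy the invariant says that after `k`
steps the remaining leftmost length is at least `n - k`, where `n` is the initial one; hence the
hitting time of the terminal state is almost surely at least `n`. For `ε = 1` the remaining length
after `k` steps is at most `n - k`, so the hitting time is almost surely equal to `n`. Integrating
gives both claims.
-/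

namespace RandStrat

/-! ### Shifting and substitution -/

namespace Term

theorem shift_shift (M : Term) : ∀ {i j : ℕ}, i ≤ j →
    shift (j + 1) (shift i M) = shift i (shift j M) := by
  induction M with
  | var n => intro i j h; grind [shift]
  | app A B ihA ihB => intro i j h; simp only [shift, ihA h, ihB h]
  | lam A ih => intro i j h; simp only [shift, ih (Nat.succ_le_succ h)]

theorem subst_shift_self (M : Term) : ∀ (j : ℕ) (N : Term), subst j N (shift j M) = M := by
  induction M with
  | var n => intro j N; grind [shift, subst]
  | app A B ihA ihB => intro j N; simp only [shift, subst, ihA, ihB]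
  | lam A ih => intro j N; simp only [shift, subst, ih]

theorem shift_subst_of_le (M : Term) : ∀ {i k : ℕ} (N : Term), i ≤ k →
    shift i (subst k N M) = subst (k + 1) (shift i N) (shift i M) := by
  induction M with
  | var n => intro i k N h; grind [shift, subst]
  | app A B ihA ihB => intro i k N h; simp only [shift, subst, ihA N h, ihB N h]
  | lam A ih =>
    intro i k N h
    simp only [shift, subst, ih _ (Nat.succ_le_succ h), shift_shift N (Nat.zero_le i)]

theorem shift_subst_of_ge (M : Term) : ∀ {j c : ℕ} (N : Term), j ≤ c →
    shift c (subst j N M) = subst j (shift c N) (shift (c + 1) M) := by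
  induction M with
  | var n => intro j c N h; grind [shift, subst]
  | app A B ihA ihB => intro j c N h; simp only [shift, subst, ihA N h, ihB N h]
  | lam A ih =>
    intro j c N h
    simp only [shift, subst, ih _ (Nat.succ_le_succ h), shift_shift N (Nat.zero_le c)]

theorem subst_subst (P : Term) : ∀ {j k : ℕ} (N Q : Term), j ≤ k →
    subst k N (subst j Q P) = subst j (subst k N Q) (subst (k + 1) (shift j N) P) := by
  induction P with
  | var n => intro j k N Q h; grind [subst, subst_shift_self]
  | app A B ihA ihB => intro j k N Q h; simp only [subst, ihA N Q h, ihB N Q h]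
  | lam A ih =>
    intro j k N Q h
    simp only [subst, ih _ _ (Nat.succ_le_succ h), shift_shift N (Nat.zero_le j),
      shift_subst_of_le Q N (Nat.zero_le k)]

/-! ### Counting occurrences -/

theorem occ_shift_of_lt (M : Term) : ∀ {k c : ℕ}, k < c → occ k (shift c M) = occ k M := by
  induction M with
  | var n => intro k c h; grind [shift, occ]
  | app A B ihA ihB => intro k c h; simp only [shift, occ, ihA h, ihB h]
  | lam A ih => intro k c h; simp only [shift, occ, ih (Nat.succ_lt_succ h)]

theorem occ_shift_self (M : Term) : ∀ c : ℕ, occ c (shift c M) = 0 := by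
  induction M with
  | var n => intro c; grind [shift, occ]
  | app A B ihA ihB => intro c; simp only [shift, occ, ihA, ihB]
  | lam A ih => intro c; simp only [shift, occ, ih]

theorem occ_succ_shift (M : Term) : ∀ {k c : ℕ}, c ≤ k → occ (k + 1) (shift c M) = occ k M := by
  induction M with
  | var n => intro k c h; grind [shift, occ]
  | app A B ihA ihB => intro k c h; simp only [shift, occ, ihA h, ihB h]
  | lam A ih => intro k c h; simp only [shift, occ, ih (Nat.succ_le_succ h)]

theorem occ_subst_of_lt (M : Term) : ∀ {k j : ℕ} (N : Term), k < j →
    occ k (subst j N M) = occ k M + occ j M * occ k N := by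
  induction M with
  | var n => intro k j N h; grind [subst, occ]
  | app A B ihA ihB => intro k j N h; simp only [subst, occ, ihA N h, ihB N h]; ring
  | lam A ih =>
    intro k j N h
    simp only [subst, occ, ih _ (Nat.succ_lt_succ h), occ_succ_shift N (Nat.zero_le k)]

theorem occ_subst_of_ge (M : Term) : ∀ {k j : ℕ} (N : Term), j ≤ k →
    occ k (subst j N M) = occ (k + 1) M + occ j M * occ k N := by
  induction M with
  | var n => intro k j N h; grind [subst, occ]
  | app A B ihA ihB => intro k j N h; simp only [subst, occ, ihA N h, ihB N h]; ring
  | lam A ih =>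
    intro k j N h
    simp only [subst, occ, ih _ (Nat.succ_le_succ h), occ_succ_shift N (Nat.zero_le k)]

theorem size_shift (M : Term) : ∀ c : ℕ, size (shift c M) = size M := by
  induction M with
  | var n => intro c; grind [shift, size]
  | app A B ihA ihB => intro c; simp only [shift, size, ihA, ihB]
  | lam A ih => intro c; simp only [shift, size, ih]

theorem size_subst_le (M : Term) : ∀ (j : ℕ) (N : Term),
    size (subst j N M) ≤ size M + occ j M * size N := by
  induction M with
  | var n => intro j N; grind [subst, size, occ]
  | app A B ihA ihB =>
    intro j N
    have := ihA j N
    have := ihB j N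
    simp only [subst, size, occ, add_mul]
    omega
  | lam A ih =>
    intro j N
    have := ih (j + 1) (shift 0 N)
    rw [size_shift] at this
    simp only [subst, size, occ]
    omega

/-! ### One-step reduction, structurally -/

theorem not_beta_var {i : ℕ} {u : Term} : ¬ Beta (var i) u := by
  rintro ⟨C, M, N, h, -⟩
  exact not_redexAt_var i C M N h

theorem beta_lam {t u : Term} : Beta (lam t) u ↔ ∃ t', Beta t t' ∧ u = lam t' := by
  constructor
  · rintro ⟨C, M, N, h, rfl⟩
    obtain ⟨D, rfl, hD⟩ := redexAt_lam.1 h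
    exact ⟨_, ⟨D, M, N, hD, rfl⟩, rfl⟩
  · rintro ⟨_, ⟨D, M, N, hD, rfl⟩, rfl⟩
    exact ⟨.lam D, M, N, redexAt_lam.2 ⟨D, rfl, hD⟩, rfl⟩

theorem beta_app {t s u : Term} : Beta (app t s) u ↔ (∃ P, t = lam P ∧ u = contractum P s) ∨
    (∃ t', Beta t t' ∧ u = app t' s) ∨ (∃ s', Beta s s' ∧ u = app t s') := by
  constructor
  · rintro ⟨C, M, N, h, rfl⟩
    rcases redexAt_app.1 h with ⟨rfl, rfl, rfl⟩ | ⟨D, rfl, hD⟩ | ⟨D, rfl, hD⟩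
    · exact .inl ⟨M, rfl, rfl⟩
    · exact .inr (.inl ⟨_, ⟨D, M, N, hD, rfl⟩, rfl⟩)
    · exact .inr (.inr ⟨_, ⟨D, M, N, hD, rfl⟩, rfl⟩)
  · rintro (⟨P, rfl, rfl⟩ | ⟨_, ⟨D, M, N, hD, rfl⟩, rfl⟩ | ⟨_, ⟨D, M, N, hD, rfl⟩, rfl⟩)
    · exact ⟨.hole, P, s, rfl, rfl⟩
    · exact ⟨.appL D s, M, N, redexAt_app.2 (.inr (.inl ⟨D, rfl, hD⟩)), rfl⟩
    · exact ⟨.appR t D, M, N, redexAt_app.2 (.inr (.inr ⟨D, rfl, hD⟩)), rfl⟩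

theorem Beta.lam {t t' : Term} (h : Beta t t') : Beta (lam t) (lam t') :=
  beta_lam.2 ⟨t', h, rfl⟩

theorem Beta.appL {t t' : Term} (h : Beta t t') (s : Term) : Beta (app t s) (app t' s) :=
  beta_app.2 (.inr (.inl ⟨t', h, rfl⟩))

theorem Beta.appR {s s' : Term} (t : Term) (h : Beta s s') : Beta (app t s) (app t s') :=
  beta_app.2 (.inr (.inr ⟨s', h, rfl⟩))

theorem Beta.root (P N : Term) : Beta (app (.lam P) N) (contractum P N) :=
  beta_app.2 (.inl ⟨P, rfl, rfl⟩)

theorem Beta.shift {t u : Term} (h : Beta t u) (c : ℕ) : Beta (shift c t) (shift c u) := by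
  induction t generalizing u c with
  | var i => exact absurd h not_beta_var
  | lam t ih =>
    obtain ⟨t', h', rfl⟩ := beta_lam.1 h
    exact (ih h' _).lam
  | app t s iht ihs =>
    rcases beta_app.1 h with ⟨P, rfl, rfl⟩ | ⟨t', h', rfl⟩ | ⟨s', h', rfl⟩
    · rw [contractum, shift_subst_of_ge P s (Nat.zero_le c)]
      exact Beta.root _ _
    · exact (iht h' c).appL _
    · exact (ihs h' c).appR _

theorem Beta.subst {t u : Term} (h : Beta t u) (k : ℕ) (N : Term) :
    Beta (Term.subst k N t) (Term.subst k N u) := by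
  induction t generalizing u k N with
  | var i => exact absurd h not_beta_var
  | lam t ih =>
    obtain ⟨t', h', rfl⟩ := beta_lam.1 h
    exact (ih h' _ _).lam
  | app t s iht ihs =>
    rcases beta_app.1 h with ⟨P, rfl, rfl⟩ | ⟨t', h', rfl⟩ | ⟨s', h', rfl⟩
    · rw [contractum, subst_subst P N s (Nat.zero_le k)]
      exact Beta.root _ _
    · exact (iht h' k N).appL _
    · exact (ihs h' k N).appR _

theorem subst_congr_of_occ_eq_zero (P : Term) : ∀ {k : ℕ} (N N' : Term), occ k P = 0 →
    subst k N P = subst k N' P := by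
  induction P with
  | var n => intro k N N' h; grind [subst, occ]
  | app A B ihA ihB =>
    intro k N N' h
    simp only [occ, Nat.add_eq_zero_iff] at h
    simp only [subst, ihA N N' h.1, ihB N N' h.2]
  | lam A ih => intro k N N' h; simp only [subst, ih _ (shift 0 N') h]

/-- A step inside an argument that is substituted for at most one occurrence is erased, or
becomes exactly one step. -/
theorem Beta.subst_arg (P : Term) : ∀ {k : ℕ} {N N' : Term}, occ k P ≤ 1 → Beta N N' →
    Term.subst k N P = Term.subst k N' P ∨ Beta (Term.subst k N P) (Term.subst k N' P) := by
  induction P with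
  | var n => intro k N N' _ h; grind [Term.subst]
  | app A B ihA ihB =>
    intro k N N' hk h
    simp only [occ] at hk
    simp only [Term.subst]
    rcases Nat.eq_zero_or_pos (occ k A) with hA | hA
    · rw [subst_congr_of_occ_eq_zero A N N' hA]
      rcases ihB (k := k) (by omega) h with e | e
      · exact .inl (by rw [e])
      · exact .inr (e.appR _)
    · rw [subst_congr_of_occ_eq_zero B N N' (by omega)]
      rcases ihA (k := k) (by omega) h with e | e
      · exact .inl (by rw [e])
      · exact .inr (e.appL _)
  | lam A ih =>
    intro k N N' hk h
    rcases ih (k := k + 1) hk (h.shift 0) with e | e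
    · exact .inl (by simp only [Term.subst, e])
    · exact .inr e.lam

/-! ### The affine calculus: closure under reduction and termination -/

theorem Affine.shift {M : Term} (h : M.Affine) : ∀ c : ℕ, (shift c M).Affine := by
  induction h with
  | var i =>
    intro c
    simp only [Term.shift]
    split_ifs <;> exact .var _
  | lam _ ho ih =>
    intro c
    exact .lam (ih _) (by rwa [occ_shift_of_lt _ (Nat.succ_pos c)])
  | app _ _ ihA ihB => intro c; exact .app (ihA c) (ihB c)

theorem Affine.subst {M : Term} (h : M.Affine) : ∀ {N : Term} (j : ℕ), N.Affine →
    (subst j N M).Affine := by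
  induction h with
  | var i =>
    intro N j hN
    simp only [Term.subst]
    split_ifs
    · exact .var _
    · exact hN
    · exact .var _
  | lam _ ho ih =>
    intro N j hN
    refine .lam (ih _ (hN.shift 0)) ?_
    rwa [occ_subst_of_lt _ _ (Nat.succ_pos j), occ_shift_self, mul_zero, add_zero]
  | app _ _ ihA ihB => intro N j hN; exact .app (ihA j hN) (ihB j hN)

theorem occ_le_of_beta {t u : Term} (ht : t.Affine) (h : Beta t u) :
    ∀ k, occ k u ≤ occ k t := by
  induction ht generalizing u with
  | var i => exact absurd h not_beta_var
  | lam _ _ ih =>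
    obtain ⟨t', h', rfl⟩ := beta_lam.1 h
    exact fun k => ih h' (k + 1)
  | @app t s htA _ iht ihs =>
    intro k
    rcases beta_app.1 h with ⟨P, rfl, rfl⟩ | ⟨t', h', rfl⟩ | ⟨s', h', rfl⟩
    · cases htA with
      | lam _ ho =>
        rw [contractum, occ_subst_of_ge P s (Nat.zero_le k)]
        exact Nat.add_le_add_left ((Nat.mul_le_mul_right _ ho).trans_eq (one_mul _)) _
    · exact Nat.add_le_add_right (iht h' k) _
    · exact Nat.add_le_add_left (ihs h' k) _

theorem Affine.of_beta {t u : Term} (ht : t.Affine) (h : Beta t u) : u.Affine := by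
  induction ht generalizing u with
  | var i => exact absurd h not_beta_var
  | lam hA ho ih =>
    obtain ⟨t', h', rfl⟩ := beta_lam.1 h
    exact .lam (ih h') ((occ_le_of_beta hA h' 0).trans ho)
  | app htA hsA iht ihs =>
    rcases beta_app.1 h with ⟨P, rfl, rfl⟩ | ⟨t', h', rfl⟩ | ⟨s', h', rfl⟩
    · cases htA with
      | lam hP _ => exact hP.subst 0 hsA
    · exact .app (iht h') hsA
    · exact .app htA (ihs h')

theorem size_lt_of_beta {t u : Term} (ht : t.Affine) (h : Beta t u) : size u < size t := by
  induction ht generalizing u with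
  | var i => exact absurd h not_beta_var
  | lam _ _ ih =>
    obtain ⟨t', h', rfl⟩ := beta_lam.1 h
    exact Nat.add_lt_add_left (ih h') 1
  | @app t s htA _ iht ihs =>
    rcases beta_app.1 h with ⟨P, rfl, rfl⟩ | ⟨t', h', rfl⟩ | ⟨s', h', rfl⟩
    · cases htA with
      | lam _ ho =>
        have h1 := size_subst_le P 0 s
        have h2 := (Nat.mul_le_mul_right (size s) ho).trans_eq (one_mul _)
        simp only [contractum, size]
        omega
    · have := iht h'
      simp only [size]; omega
    · have := ihs h'
      simp only [size]; omega

/-! ### Leftmost reduction against an arbitrary step -/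

/-- A step that turns an application into an abstraction contracts the root. -/
theorem leftmost_of_beta_lam {t P : Term} (ht : ∀ Q, t ≠ lam Q) (h : Beta t (lam P)) :
    leftmost t = some (lam P) := by
  cases t with
  | var i => exact absurd h not_beta_var
  | lam Q => exact absurd rfl (ht Q)
  | app A B =>
    rcases beta_app.1 h with ⟨Q, rfl, e⟩ | ⟨_, _, e⟩ | ⟨_, _, e⟩
    · simp [leftmost, e]
    · cases e
    · cases e

/-- Local confluence of the leftmost step with any other step of an affine term: the leftmost
redex stays leftmost, and the other redex has at most one residual. -/
theorem leftmost_diamond {t u v : Term} (ht : t.Affine) (hv : leftmost t = some v)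
    (hu : Beta t u) : u = v ∨ ∃ w, leftmost u = some w ∧ (v = w ∨ Beta v w) := by
  induction ht generalizing u v with
  | var i => exact absurd hu not_beta_var
  | lam _ _ ih =>
    simp only [leftmost, Option.map_eq_some_iff] at hv
    obtain ⟨v', hv', rfl⟩ := hv
    obtain ⟨u', hu', rfl⟩ := beta_lam.1 hu
    rcases ih hv' hu' with rfl | ⟨w, hw, e⟩
    · exact .inl rfl
    · refine .inr ⟨lam w, by simp [leftmost, hw], ?_⟩
      exact e.imp (congrArg lam) Beta.lam
  | @app t s htA _ iht ihs =>
    by_cases hlam : ∃ P, t = lam P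
    · obtain ⟨P, rfl⟩ := hlam
      simp only [leftmost, Option.some.injEq] at hv
      subst hv
      rcases beta_app.1 hu with ⟨Q, e, rfl⟩ | ⟨t', h', rfl⟩ | ⟨s', h', rfl⟩
      · cases e
        exact .inl rfl
      · obtain ⟨P', h'', rfl⟩ := beta_lam.1 h'
        exact .inr ⟨contractum P' s, by rw [leftmost], .inr (h''.subst 0 s)⟩
      · cases htA with
        | lam _ ho => exact .inr ⟨contractum P s', by rw [leftmost], Beta.subst_arg P ho h'⟩
    · have hne : ∀ P, t ≠ lam P := fun P h => hlam ⟨P, h⟩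
      rw [leftmost_app_of_ne hne] at hv
      cases hl : leftmost t with
      | some v' =>
        simp only [hl, Option.some.injEq] at hv
        subst hv
        rcases beta_app.1 hu with ⟨Q, e, rfl⟩ | ⟨t', h', rfl⟩ | ⟨s', h', rfl⟩
        · exact absurd e (hne Q)
        · by_cases hlam' : ∃ P, t' = lam P
          · obtain ⟨P, rfl⟩ := hlam'
            rw [leftmost_of_beta_lam hne h', Option.some.injEq] at hl
            exact .inl (by rw [hl])
          · rcases iht hl h' with rfl | ⟨w, hw, e⟩
            · exact .inl rfl
            · refine .inr ⟨app w s, ?_, e.imp (fun e => by rw [e]) fun e => e.appL s⟩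
              rw [leftmost_app_of_ne fun P h => hlam' ⟨P, h⟩, hw]
        · exact .inr ⟨app v' s', by rw [leftmost_app_of_ne hne, hl], .inr (h'.appR v')⟩
      | none =>
        simp only [hl, Option.map_eq_some_iff] at hv
        obtain ⟨v', hv', rfl⟩ := hv
        rcases beta_app.1 hu with ⟨Q, e, rfl⟩ | ⟨t', h', rfl⟩ | ⟨s', h', rfl⟩
        · exact absurd e (hne Q)
        · exact absurd h' (leftmost_eq_none_iff.1 hl t')
        · rcases ihs hv' h' with rfl | ⟨w, hw, e⟩
          · exact .inl rfl
          · refine .inr ⟨app t w, ?_, e.imp (congrArg (app t)) (Beta.appR t)⟩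
            rw [leftmost_app_of_ne hne, hl, hw]
            rfl

/-- `LOLength t n`: leftmost reduction from `t` reaches a normal form in exactly `n` steps. -/
inductive LOLength : Term → ℕ → Prop
  | nf {t : Term} : leftmost t = none → LOLength t 0
  | step {t u : Term} {n : ℕ} : leftmost t = some u → LOLength u n → LOLength t (n + 1)

theorem Affine.exists_loLength {t : Term} (ht : t.Affine) : ∃ n, LOLength t n := by
  induction hs : size t using Nat.strong_induction_on generalizing t with
  | _ m ih =>
    subst hs
    cases hl : leftmost t with
    | none => exact ⟨0, .nf hl⟩
    | some u =>
      have hb := leftmost_beta hl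
      obtain ⟨n, hn⟩ := ih _ (size_lt_of_beta ht hb) (ht.of_beta hb) rfl
      exact ⟨n + 1, .step hl hn⟩

/-- A single step of any kind shortens leftmost reduction by at most one step. -/
theorem LOLength.of_beta {t u : Term} {n : ℕ} (hn : LOLength t n) (ht : t.Affine)
    (hu : Beta t u) : ∃ m, LOLength u m ∧ n ≤ m + 1 := by
  induction hn generalizing u with
  | nf h => exact absurd hu (leftmost_eq_none_iff.1 h u)
  | @step t v n hv hn ih =>
    rcases leftmost_diamond ht hv hu with rfl | ⟨w, hw, rfl | hvw⟩
    · exact ⟨n, hn, le_rfl⟩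
    · exact ⟨n + 1, .step hw hn, by omega⟩
    · obtain ⟨m, hm, hle⟩ := ih (ht.of_beta (leftmost_beta hv)) hvw
      exact ⟨m + 1, .step hw hm, by omega⟩

theorem LOLength.eq_zero_of_isNF {t : Term} {n : ℕ} (hn : LOLength t n) (h : IsNF Beta t) :
    n = 0 := by
  cases hn with
  | nf _ => rfl
  | step hl _ => exact absurd (leftmost_beta hl) (h _)

theorem LOLength.normalizesIn {t : Term} {n : ℕ} (hn : LOLength t n) : LO.NormalizesIn t n := by
  induction hn with
  | @nf t h =>
    exact ⟨fun _ => t, rfl, fun i hi => absurd hi (Nat.not_lt_zero i), leftmost_eq_none_iff.1 h⟩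
  | @step t u n hl _ ih =>
    obtain ⟨σ, h0, hσ, hnf⟩ := ih
    refine ⟨fun i => i.casesOn t σ, rfl, ?_, hnf⟩
    rintro (_ | i) hi
    · exact hl.trans (congrArg some h0.symm)
    · exact hσ i (Nat.lt_of_succ_lt_succ hi)

end Term

/-! ### Almost sure invariants of the Markov chain -/

section Chain

open MeasureTheory ProbabilityTheory

variable {S : Type*} {r : S → S → Prop}

theorem PARS.transition_mk_of_none (P : PARS r) {s : S} (h : P.toFun s = none) :
    P.transition (State.mk r s) = PMF.pure (State.mk r s) := by
  change (match P.toFun s with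
    | none => PMF.pure (State.mk r s)
    | some μ => μ.map (State.mk r)) = _
  rw [h]

theorem PARS.transition_mk_of_some (P : PARS r) {s : S} {μ : PMF S} (h : P.toFun s = some μ) :
    P.transition (State.mk r s) = μ.map (State.mk r) := by
  change (match P.toFun s with
    | none => PMF.pure (State.mk r s)
    | some μ => μ.map (State.mk r)) = _
  rw [h]

theorem State.isNF_of_mk_mem_trm {s : S} (h : State.mk r s ∈ trm r) : IsNF r s := by
  obtain ⟨t, ht, e⟩ := h
  rcases Quotient.exact (s := trmSetoid r) e with rfl | ⟨_, hs⟩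
  · exact ht
  · exact hs

/-- A time-dependent family of sets of states that contains the starting state and that no
transition of positive probability leaves is never left, almost surely. -/
theorem PARS.ae_forall_mem (P : PARS r) (s : S) (A : ℕ → Set (State r))
    (h0 : State.mk r s ∈ A 0)
    (hA : ∀ k, ∀ q ∈ A k, (P.transition q).support ⊆ A (k + 1)) :
    ∀ᵐ ω ∂P.law s, ∀ k, ω k ∈ A k := by
  rw [ae_all_iff]
  intro k
  induction k with
  | zero =>
    have hmap : (P.law s).map (Preorder.frestrictLe 0) =
        Measure.dirac (fun _ : Finset.Iic 0 => State.mk r s) := by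
      rw [PARS.law, Kernel.traj_map_frestrictLe_apply, Kernel.partialTraj_self, Kernel.id_apply]
    have hm : MeasurableSet {h : Finset.Iic 0 → State r | h ⟨0, Finset.mem_Iic.2 le_rfl⟩ ∈ A 0} :=
      measurable_pi_apply _ (MeasurableSpace.measurableSet_top)
    have hstart : ∀ᵐ h ∂(P.law s).map (Preorder.frestrictLe 0),
        h ⟨0, Finset.mem_Iic.2 le_rfl⟩ ∈ A 0 := by
      rw [hmap, ae_dirac_iff hm]
      exact h0
    exact ae_of_ae_map (Preorder.measurable_frestrictLe 0).aemeasurable hstart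
  | succ k ih =>
    -- The joint law of the history up to time `k` and the state at time `k + 1`.
    have hmap := Kernel.partialTraj_compProd_eq_map_traj (X := fun _ => State r)
      (κ := P.stepKernel) (Nat.zero_le k) (x₀ := fun _ => State.mk r s)
    have hstep : ∀ᵐ p ∂(P.law s).map (fun x => (Preorder.frestrictLe k x, x (k + 1))),
        p.1 ⟨k, Finset.mem_Iic.2 le_rfl⟩ ∈ A k → p.2 ∈ A (k + 1) := by
      rw [PARS.law, ← hmap]
      refine Measure.ae_compProd_of_ae_ae ?_ (ae_of_all _ fun h => ?_)
      · refine MeasurableSet.imp ?_ ?_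
        · exact ((measurable_pi_apply _).comp measurable_fst) MeasurableSpace.measurableSet_top
        · exact measurable_snd MeasurableSpace.measurableSet_top
      · by_cases hk : h ⟨k, Finset.mem_Iic.2 le_rfl⟩ ∈ A k
        · change ∀ᵐ y ∂(P.transition (h ⟨k, Finset.mem_Iic.2 le_rfl⟩)).toMeasure, _
          have hone := (PMF.toMeasure_apply_eq_one_iff _
            (MeasurableSpace.measurableSet_top)).2 (hA k _ hk)
          rw [← prob_compl_eq_zero_iff MeasurableSpace.measurableSet_top] at hone
          filter_upwards [measure_eq_zero_iff_ae_notMem.1 hone] with y hy _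
          exact not_not.1 hy
        · exact ae_of_all _ fun y h' => absurd h' hk
    have hstep' := ae_of_ae_map (by fun_prop) hstep
    filter_upwards [ih, hstep'] with ω h h'
    exact h' h

theorem le_hitTime {ω : ℕ → State r} {n : ℕ} (h : ∀ k, ω k ∈ trm r → n ≤ k) :
    (n : ℕ∞) ≤ hitTime r ω := by
  by_contra! hlt
  have hk' : hittingAfter (fun (n : ℕ) (ω : ℕ → State r) => ω n) (trm r) 0 ω < (n : ℕ∞) := hlt
  obtain ⟨j, hj, hmem⟩ := (hittingAfter_lt_iff).1 hk'
  exact absurd (h j hmem) (not_le.2 hj.2)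

theorem hitTime_le {ω : ℕ → State r} {n : ℕ} (h : ω n ∈ trm r) : hitTime r ω ≤ n :=
  hittingAfter_le_of_mem (Nat.zero_le n) h

end Chain

/-! ### The derivation length of affine terms -/

open MeasureTheory Term

/-- Whatever a strategy does on an affine term, it almost surely needs at least as many steps as
leftmost reduction. -/
theorem PARS.ae_le_hitTime (P : PARS Beta) {M : Term} {n : ℕ} (hM : M.Affine)
    (hn : LOLength M n) : ∀ᵐ ω ∂P.law M, (n : ℕ∞) ≤ hitTime Beta ω := by
  -- Each step lowers the leftmost length by at most one: it is at least `n - k` at time `k`.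
  have key := P.ae_forall_mem M
    (fun k => {q | ∃ t m, State.mk Beta t = q ∧ t.Affine ∧ LOLength t m ∧ n ≤ m + k})
    ⟨M, n, rfl, hM, hn, le_rfl⟩ ?_
  · filter_upwards [key] with ω hω
    refine le_hitTime fun k hk => ?_
    obtain ⟨t, m, e, -, hm, hle⟩ := hω k
    rw [← e] at hk
    have := hm.eq_zero_of_isNF (State.isNF_of_mk_mem_trm hk)
    omega
  · rintro k _ ⟨t, m, rfl, ht, hm, hle⟩ q hq
    cases hP : P.toFun t with
    | none =>
      rw [P.transition_mk_of_none hP, PMF.support_pure, Set.mem_singleton_iff] at hq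
      exact ⟨t, m, hq.symm, ht, hm, by omega⟩
    | some μ =>
      rw [P.transition_mk_of_some hP, PMF.mem_support_map_iff] at hq
      obtain ⟨u, hu, rfl⟩ := hq
      have hb := P.rel_of_mem_support t μ hP u hu
      obtain ⟨m', hm', hle'⟩ := hm.of_beta ht hb
      exact ⟨u, m', rfl, ht.of_beta hb, hm', by omega⟩

theorem mix_one {α : Type*} (a b : α) : mix 1 a b = PMF.pure a := by
  classical
  ext c
  rw [PMF.pure_apply]
  change (if c = a then ENNReal.ofReal (1 : unitInterval) else 0) +
    (if c = b then ENNReal.ofReal (1 - (1 : unitInterval)) else 0) = _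
  simp

theorem Peps_one_toFun {t u : Term} (h : leftmost t = some u) :
    (Peps 1).toFun t = some (PMF.pure u) := by
  obtain ⟨v, hv⟩ : ∃ v, rightmost t = some v := Option.ne_none_iff_exists'.1 fun hr =>
    rightmost_eq_none_iff.1 hr u (leftmost_beta h)
  change (match leftmost t, rightmost t with
    | some u, some v => some (mix 1 u v)
    | _, _ => none) = _
  rw [h, hv]
  simp only [mix_one]

/-- With `ε = 1` the chain follows leftmost reduction. -/
theorem ae_hitTime_Peps_one_le {M : Term} {n : ℕ} (hn : LOLength M n) :
    ∀ᵐ ω ∂(Peps 1).law M, hitTime Beta ω ≤ n := by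
  have key := (Peps 1).ae_forall_mem M
    (fun k => {q | ∃ t m, State.mk Beta t = q ∧ LOLength t m ∧ m ≤ n - k})
    ⟨M, n, rfl, hn, le_rfl⟩ ?_
  · filter_upwards [key] with ω hω
    obtain ⟨t, m, e, hm, hle⟩ := hω n
    refine hitTime_le ⟨t, ?_, e⟩
    cases hm with
    | nf hl => exact leftmost_eq_none_iff.1 hl
    | step _ _ => omega
  · rintro k _ ⟨t, m, rfl, hm, hle⟩ q hq
    cases hm with
    | nf hl =>
      rw [(Peps 1).transition_mk_of_none
        (((Peps 1).eq_none_iff t).2 (leftmost_eq_none_iff.1 hl)), PMF.support_pure,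
        Set.mem_singleton_iff] at hq
      exact ⟨t, 0, hq.symm, .nf hl, Nat.zero_le _⟩
    | @step _ u m hl hm =>
      rw [(Peps 1).transition_mk_of_some (Peps_one_toFun hl), PMF.pure_map, PMF.support_pure,
        Set.mem_singleton_iff] at hq
      exact ⟨u, m, hq.symm, hm, by omega⟩

theorem PARS.le_avgLength (P : PARS Beta) {M : Term} {n : ℕ} (hM : M.Affine)
    (hn : LOLength M n) : (n : ℝ≥0∞) ≤ P.avgLength M := by
  have : IsProbabilityMeasure (P.law M) :=
    inferInstanceAs (IsProbabilityMeasure (ProbabilityTheory.Kernel.traj _ 0 _))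
  calc
    (n : ℝ≥0∞) = ∫⁻ _, (n : ℝ≥0∞) ∂P.law M := by simp
    _ ≤ P.avgLength M := lintegral_mono_ae <| by
      filter_upwards [P.ae_le_hitTime hM hn] with ω hω
      exact_mod_cast ENat.toENNReal_le.2 hω

theorem avgLength_Peps_one_le {M : Term} {n : ℕ} (hn : LOLength M n) :
    (Peps 1).avgLength M ≤ n := by
  have : IsProbabilityMeasure ((Peps 1).law M) :=
    inferInstanceAs (IsProbabilityMeasure (ProbabilityTheory.Kernel.traj _ 0 _))
  calc
    (Peps 1).avgLength M ≤ ∫⁻ _, (n : ℝ≥0∞) ∂(Peps 1).law M := lintegral_mono_ae <| by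
      filter_upwards [ae_hitTime_Peps_one_le hn] with ω hω
      exact_mod_cast ENat.toENNReal_le.2 hω
    _ = n := by simp

end RandStrat

theorem mainTheorem3 (M : RandStrat.Term) (hM : M.Affine) :
    (∀ ε : unitInterval,
      (RandStrat.Peps 1).avgLength M ≤ (RandStrat.Peps ε).avgLength M) ∧
    ∃ n : ℕ, RandStrat.LO.NormalizesIn M n ∧ (RandStrat.Peps 1).avgLength M = n := by
  obtain ⟨n, hn⟩ := hM.exists_loLength
  have hle := RandStrat.avgLength_Peps_one_le hn
  exact ⟨fun ε => hle.trans ((RandStrat.Peps ε).le_avgLength hM hn), n, hn.normalizesIn,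
    le_antisymm hle ((RandStrat.Peps 1).le_avgLength hM hn)⟩
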